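/- Let $\mathbf A$ be a finite Boolean algebra with $\bot\neq\top$, put $A'=A\setminus\{\bot\}$, and let $\mathcal C(\mathbf A)$ be its Boolean algebra of conditionals: the quotient of the free Boolean algebra generated by the pairs $(a\mid b)$, $a\in A$, $b\in A'$, by the congruence generated by the identifications $(b\mid b)=\top$; $(a_1\mid b)\sqcap(a_2\mid b)=(a_1\wedge a_2\mid b)$; $\sim(a\mid b)=(\neg a\mid b)$; $(a\wedge b\mid b)=(a\mid b)$; and $(a\mid b)\sqcap(b\mid c)=(a\mid c)$ whenever $a\le b\le c$ (for all elements of $A$, with antecedents in $A'$). The images of the generators are the basic conditionals. A probability on a Boolean algebra is a finitely additive map into $[0,1]$ with value $1$ at $\top$; it is positive if it is strictly positive on every element other than $\bot$. For a positive probability $P$ on $\mathbf A$, the canonical extension $\mu_P$ of $P$ to $\mathcal C(\mathbf A)$ is defined as follows. Let $n$ be the number of atoms of $\mathbf A$. The atoms of $\mathcal C(\mathbf A)$ are the pairwise different elements $$\omega_{\overline\alpha}=(\alpha_1\mid\top)\sqcap(\alpha_2\mid\neg\alpha_1)\sqcap\dots\sqcap(\alpha_{n-1}\mid\neg\alpha_1\wedge\dots\wedge\neg\alpha_{n-2}),$$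 where $\overline\alpha=\langle\alpha_1,\dots,\alpha_{n-1}\rangle$ ranges over the sequences of $n-1$ pairwise different atoms of $\mathbf A$. Put $$\mu_P(\omega_{\overline\alpha})=\prod_{i=1}^{n-1}\frac{P(\alpha_i\wedge\neg\alpha_1\wedge\dots\wedge\neg\alpha_{i-1})}{P(\neg\alpha_1\wedge\dots\wedge\neg\alpha_{i-1})},$$ and let $\mu_P(t)$ be the sum of $\mu_P(\omega)$ over all atoms $\omega\le t$, for $t\in\mathcal C(\mathbf A)$. Let $\mu$ be a positive probability on $\mathcal C(\mathbf A)$. Then the following are equivalent: (i) $\mu$ is separable, i.e. $\mu(a\mid c)=\mu(a\mid b)\cdot\mu(b\mid c)$ for all $a\in A$ and $b,c\in A'$ with $a\le b\le c$; (ii) there is a positive probability $P_\mu$ on $\mathbf A$ such that for every basic conditional $(a\mid b)$, $a\in A$, $b\in A'$, $$\mu(a\mid b)=\frac{P_\mu(a\wedge b)}{P_\mu(b)}=\mu_{P_\mu}(a\mid b).$$ -/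

import Mathlib

/-- Boolean terms over a set `V` of propositional variables. -/
inductive BoolTerm (V : Type*) : Type _
  | var : V → BoolTerm V
  | bot : BoolTerm V
  | top : BoolTerm V
  | inf : BoolTerm V → BoolTerm V → BoolTerm V
  | sup : BoolTerm V → BoolTerm V → BoolTerm V
  | compl : BoolTerm V → BoolTerm V

/-- Two Boolean terms are equivalent when one can be rewritten into the other by the laws of
Boolean algebras. -/
inductive BoolTerm.Equivalent {V : Type*} : BoolTerm V → BoolTerm V → Prop
  | refl (s : BoolTerm V) : Equivalent s s
  | symm {s t : BoolTerm V} : Equivalent s t → Equivalent t s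
  | trans {s t u : BoolTerm V} : Equivalent s t → Equivalent t u → Equivalent s u
  | inf_congr {s s' t t' : BoolTerm V} : Equivalent s s' → Equivalent t t' → Equivalent (s.inf t) (s'.inf t')
  | sup_congr {s s' t t' : BoolTerm V} : Equivalent s s' → Equivalent t t' → Equivalent (s.sup t) (s'.sup t')
  | compl_congr {s s' : BoolTerm V} : Equivalent s s' → Equivalent s.compl s'.compl
  | inf_comm (s t : BoolTerm V) : Equivalent (s.inf t) (t.inf s)
  | sup_comm (s t : BoolTerm V) : Equivalent (s.sup t) (t.sup s)
  | inf_assoc (s t u : BoolTerm V) : Equivalent ((s.inf t).inf u) (s.inf (t.inf u))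
  | sup_assoc (s t u : BoolTerm V) : Equivalent ((s.sup t).sup u) (s.sup (t.sup u))
  | inf_sup_self (s t : BoolTerm V) : Equivalent (s.inf (s.sup t)) s
  | sup_inf_self (s t : BoolTerm V) : Equivalent (s.sup (s.inf t)) s
  | inf_sup_left (s t u : BoolTerm V) : Equivalent (s.inf (t.sup u)) ((s.inf t).sup (s.inf u))
  | sup_inf_left (s t u : BoolTerm V) : Equivalent (s.sup (t.inf u)) ((s.sup t).inf (s.sup u))
  | inf_top (s : BoolTerm V) : Equivalent (s.inf BoolTerm.top) s
  | sup_bot (s : BoolTerm V) : Equivalent (s.sup BoolTerm.bot) s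
  | inf_compl (s : BoolTerm V) : Equivalent (s.inf s.compl) BoolTerm.bot
  | sup_compl (s : BoolTerm V) : Equivalent (s.sup s.compl) BoolTerm.top

/-- A set with operations satisfying the equational laws is a Boolean algebra, with the
order `a ≤ b ↔ a ⊔ b = b`. -/
abbrev BooleanAlgebra.ofEquations {B : Type*} (sup inf : B → B → B) (compl : B → B) (bot top : B)
    (sup_comm : ∀ a b, sup a b = sup b a)
    (sup_assoc : ∀ a b c, sup (sup a b) c = sup a (sup b c))
    (inf_comm : ∀ a b, inf a b = inf b a)
    (inf_assoc : ∀ a b c, inf (inf a b) c = inf a (inf b c))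
    (sup_inf_self : ∀ a b, sup a (inf a b) = a)
    (inf_sup_self : ∀ a b, inf a (sup a b) = a)
    (sup_inf_left : ∀ a b c, sup a (inf b c) = inf (sup a b) (sup a c))
    (inf_top : ∀ a, inf a top = a) (sup_bot : ∀ a, sup a bot = a)
    (inf_compl : ∀ a, inf a (compl a) = bot) (sup_compl : ∀ a, sup a (compl a) = top) :
    BooleanAlgebra B :=
  letI : Max B := ⟨sup⟩
  letI : Min B := ⟨inf⟩
  { Lattice.mk' sup_comm sup_assoc inf_comm inf_assoc sup_inf_self inf_sup_self with
    compl := compl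
    bot := bot
    top := top
    le_sup_inf := fun a b c => by
      change sup (inf (sup a b) (sup a c)) (sup a (inf b c)) = sup a (inf b c)
      rw [← sup_inf_left]
      simpa only [inf_top] using sup_inf_self (sup a (inf b c)) top
    inf_compl_le_bot := fun a => by
      change sup (inf a (compl a)) bot = bot
      rw [sup_bot, inf_compl]
    top_le_sup_compl := fun a => by
      change sup top (sup a (compl a)) = sup a (compl a)
      simpa only [inf_top, sup_compl] using sup_inf_self top top
    le_top := fun a => by
      change sup a top = top
      rw [sup_comm, ← inf_top a, inf_comm a, sup_inf_self]
    bot_le := fun a => by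
      change sup bot a = a
      rw [sup_comm, sup_bot] }

/-- Equivalence of Boolean terms as a setoid. -/
def BoolTerm.setoid (V : Type*) : Setoid (BoolTerm V) where
  r := BoolTerm.Equivalent
  iseqv := ⟨.refl, .symm, .trans⟩

/-- The free Boolean algebra on `V`: Boolean terms modulo the laws of Boolean algebras. -/
def FreeBoolAlg (V : Type*) : Type _ := Quotient (BoolTerm.setoid V)

namespace FreeBoolAlg

variable {V : Type*}

/-- The free generator attached to a variable. -/
def of (v : V) : FreeBoolAlg V := Quotient.mk (BoolTerm.setoid V) (.var v)

instance : BooleanAlgebra (FreeBoolAlg V) :=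
  BooleanAlgebra.ofEquations
    (Quotient.map₂ .sup fun _ _ h _ _ k => .sup_congr h k)
    (Quotient.map₂ .inf fun _ _ h _ _ k => .inf_congr h k)
    (Quotient.map .compl fun _ _ h => .compl_congr h)
    (Quotient.mk (BoolTerm.setoid V) .bot)
    (Quotient.mk (BoolTerm.setoid V) .top)
    (by rintro ⟨a⟩ ⟨b⟩; exact Quotient.sound (.sup_comm a b))
    (by rintro ⟨a⟩ ⟨b⟩ ⟨c⟩; exact Quotient.sound (.sup_assoc a b c))
    (by rintro ⟨a⟩ ⟨b⟩; exact Quotient.sound (.inf_comm a b))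
    (by rintro ⟨a⟩ ⟨b⟩ ⟨c⟩; exact Quotient.sound (.inf_assoc a b c))
    (by rintro ⟨a⟩ ⟨b⟩; exact Quotient.sound (.sup_inf_self a b))
    (by rintro ⟨a⟩ ⟨b⟩; exact Quotient.sound (.inf_sup_self a b))
    (by rintro ⟨a⟩ ⟨b⟩ ⟨c⟩; exact Quotient.sound (.sup_inf_left a b c))
    (by rintro ⟨a⟩; exact Quotient.sound (.inf_top a))
    (by rintro ⟨a⟩; exact Quotient.sound (.sup_bot a))
    (by rintro ⟨a⟩; exact Quotient.sound (.inf_compl a))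
    (by rintro ⟨a⟩; exact Quotient.sound (.sup_compl a))

end FreeBoolAlg

/-- The congruence of a Boolean algebra `B` generated by a relation `X`: the smallest equivalence
relation containing `X` and compatible with the operations. -/
inductive BoolCongGen {B : Type*} [BooleanAlgebra B] (X : B → B → Prop) : B → B → Prop
  | of {x y} : X x y → BoolCongGen X x y
  | refl (x) : BoolCongGen X x x
  | symm {x y} : BoolCongGen X x y → BoolCongGen X y x
  | trans {x y z} : BoolCongGen X x y → BoolCongGen X y z → BoolCongGen X x z
  | inf {x x' y y'} : BoolCongGen X x x' → BoolCongGen X y y' → BoolCongGen X (x ⊓ y) (x' ⊓ y')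
  | sup {x x' y y'} : BoolCongGen X x x' → BoolCongGen X y y' → BoolCongGen X (x ⊔ y) (x' ⊔ y')
  | compl {x x'} : BoolCongGen X x x' → BoolCongGen X xᶜ x'ᶜ

/-- The generated congruence as a setoid. -/
def BoolCongGen.setoid {B : Type*} [BooleanAlgebra B] (X : B → B → Prop) : Setoid B where
  r := BoolCongGen X
  iseqv := ⟨.refl, .symm, .trans⟩

/-- The quotient of a Boolean algebra by the congruence generated by `X`. -/
def BoolQuotient {B : Type*} [BooleanAlgebra B] (X : B → B → Prop) : Type _ :=
  Quotient (BoolCongGen.setoid X)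

namespace BoolQuotient

variable {B : Type*} [BooleanAlgebra B] (X : B → B → Prop)

/-- The class of an element. -/
def mk (x : B) : BoolQuotient X := Quotient.mk (BoolCongGen.setoid X) x

instance : BooleanAlgebra (BoolQuotient X) :=
  BooleanAlgebra.ofEquations
    (Quotient.map₂ (fun x y => x ⊔ y) fun _ _ h _ _ k => .sup h k)
    (Quotient.map₂ (fun x y => x ⊓ y) fun _ _ h _ _ k => .inf h k)
    (Quotient.map (fun x => xᶜ) fun _ _ h => .compl h)
    (mk X ⊥)
    (mk X ⊤)
    (by rintro ⟨a⟩ ⟨b⟩; exact congrArg (mk X) (sup_comm a b))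
    (by rintro ⟨a⟩ ⟨b⟩ ⟨c⟩; exact congrArg (mk X) (sup_assoc a b c))
    (by rintro ⟨a⟩ ⟨b⟩; exact congrArg (mk X) (inf_comm a b))
    (by rintro ⟨a⟩ ⟨b⟩ ⟨c⟩; exact congrArg (mk X) (inf_assoc a b c))
    (by rintro ⟨a⟩ ⟨b⟩; exact congrArg (mk X) (sup_inf_self (a := a) (b := b)))
    (by rintro ⟨a⟩ ⟨b⟩; exact congrArg (mk X) (inf_sup_self (a := a) (b := b)))
    (by rintro ⟨a⟩ ⟨b⟩ ⟨c⟩; exact congrArg (mk X) (sup_inf_left a b c))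
    (by rintro ⟨a⟩; exact congrArg (mk X) (inf_top_eq a))
    (by rintro ⟨a⟩; exact congrArg (mk X) (sup_bot_eq a))
    (by rintro ⟨a⟩; exact congrArg (mk X) (inf_compl_self a))
    (by rintro ⟨a⟩; exact congrArg (mk X) (sup_compl_eq_top (x := a)))

end BoolQuotient

section Conditionals

variable (A : Type*) [BooleanAlgebra A]

/-- The set `A ∣ A` of pairs `(a ∣ b)` with `a ∈ A` and `b ∈ A' = A \ {⊥}`. -/
abbrev CondPair : Type _ := A × {b : A // b ≠ ⊥}

variable {A}

/-- The free generator `(a ∣ b)` of `Free(A ∣ A)`. -/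
def freeCond (a b : A) (hb : b ≠ ⊥) : FreeBoolAlg (CondPair A) := FreeBoolAlg.of (a, ⟨b, hb⟩)

variable (A)

/-- The pairs of elements of `Free(A ∣ A)` that are identified in the algebra of conditionals. -/
inductive CondRel : FreeBoolAlg (CondPair A) → FreeBoolAlg (CondPair A) → Prop
  | self (b : A) (hb : b ≠ ⊥) : CondRel (freeCond b b hb) ⊤
  | inf (a₁ a₂ b : A) (hb : b ≠ ⊥) :
      CondRel (freeCond a₁ b hb ⊓ freeCond a₂ b hb) (freeCond (a₁ ⊓ a₂) b hb)
  | compl (a b : A) (hb : b ≠ ⊥) : CondRel (freeCond a b hb)ᶜ (freeCond aᶜ b hb)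
  | inf_self (a b : A) (hb : b ≠ ⊥) : CondRel (freeCond (a ⊓ b) b hb) (freeCond a b hb)
  | chain (a b c : A) (hb : b ≠ ⊥) (hc : c ≠ ⊥) : a ≤ b → b ≤ c →
      CondRel (freeCond a b hb ⊓ freeCond b c hc) (freeCond a c hc)

/-- The Boolean algebra of conditionals `C(A)`: the quotient of `Free(A ∣ A)` by the congruence
generated by `CondRel`. -/
def CondAlg : Type _ := BoolQuotient (CondRel A)

instance : BooleanAlgebra (CondAlg A) := inferInstanceAs (BooleanAlgebra (BoolQuotient (CondRel A)))

variable {A}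

/-- The basic conditional `(a ∣ b)`, `b ≠ ⊥`, as an element of `C(A)`. -/
def basicCond (a b : A) (hb : b ≠ ⊥) : CondAlg A := BoolQuotient.mk (CondRel A) (freeCond a b hb)

end Conditionals

/-- A finitely additive probability `B → [0,1]` on a Boolean algebra. -/
structure IsProbability {B : Type*} [BooleanAlgebra B] (μ : B → ℝ) : Prop where
  mem_Icc : ∀ x, μ x ∈ Set.Icc (0 : ℝ) 1
  top : μ ⊤ = 1
  sup : ∀ x y, x ⊓ y = ⊥ → μ (x ⊔ y) = μ x + μ y

/-- A probability is positive if it is strictly positive on every element other than `⊥`. -/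
structure IsPositiveProbability {B : Type*} [BooleanAlgebra B] (μ : B → ℝ) : Prop
    extends IsProbability μ where
  pos : ∀ x, x ≠ ⊥ → 0 < μ x

section Measures

variable {A : Type*} [BooleanAlgebra A]

/-- Separability of `μ : C(A) → ℝ`: the chain rule
`μ(a ∣ c) = μ(a ∣ b) · μ(b ∣ c)` whenever `a ≤ b ≤ c`. -/
def IsSeparableProb (μ : CondAlg A → ℝ) : Prop :=
  ∀ (a b c : A) (hb : b ≠ ⊥) (hc : c ≠ ⊥), a ≤ b → b ≤ c →
    μ (basicCond a c hc) = μ (basicCond a b hb) * μ (basicCond b c hc)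

variable (A)

/-- `Seq(A)`: sequences of `n - 1` pairwise different atoms of `A`, where `n` is the number of
atoms of `A`. -/
abbrev AtomSeq : Type _ := Fin (Nat.card {a : A // IsAtom a} - 1) ↪ {a : A // IsAtom a}

variable {A}

/-- The antecedent `¬α₁ ∧ … ∧ ¬αᵢ₋₁` attached to the `i`-th term of a sequence of atoms
(it is `⊤` for the first term). -/
noncomputable def AtomSeq.antecedent (α : AtomSeq A)
    (i : Fin (Nat.card {a : A // IsAtom a} - 1)) : A :=
  (Finset.univ.filter (· < i)).inf fun j => ((α j : A))ᶜ

theorem AtomSeq.antecedent_ne_bot (α : AtomSeq A)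
    (i : Fin (Nat.card {a : A // IsAtom a} - 1)) : α.antecedent i ≠ ⊥ := by
  have h : (α i : A) ≤ α.antecedent i := by
    refine Finset.le_inf fun j hj => ?_
    have hij : α i ≠ α j := fun e => by
      have := α.injective e
      simp [this] at hj
    exact ((α i).2.disjoint_of_ne (α j).2 fun e => hij (Subtype.ext e)).le_compl_right
  exact fun e => (α i).2.1 (le_bot_iff.1 (e ▸ h))

/-- `ω_α = (α₁ ∣ ⊤) ⊓ (α₂ ∣ ¬α₁) ⊓ … ⊓ (αₙ₋₁ ∣ ¬α₁ ∧ … ∧ ¬αₙ₋₂)`, an element of `C(A)`. -/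
noncomputable def AtomSeq.omega (α : AtomSeq A) : CondAlg A :=
  Finset.univ.inf fun i => basicCond (α i : A) (α.antecedent i) (α.antecedent_ne_bot i)

/-- `P(α₁) · P(α₂ ∣ ¬α₁) · … · P(αₙ₋₁ ∣ ¬α₁ ∧ … ∧ ¬αₙ₋₂)`, where `P(a ∣ b) = P(a ∧ b) / P(b)`. -/
noncomputable def AtomSeq.weight (P : A → ℝ) (α : AtomSeq A) : ℝ :=
  ∏ i, P ((α i : A) ⊓ α.antecedent i) / P (α.antecedent i)

/-- The distribution on the atoms of `C(A)` that sends `ω_α` to the weight of `α`, for `α` in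
`Seq(A)` (for finite nontrivial `A` the map `α ↦ ω_α` is a bijection from `Seq(A)` onto the atoms
of `C(A)`). -/
noncomputable def canonicalDistribution (P : A → ℝ) : CondAlg A → ℝ :=
  Function.extend AtomSeq.omega (AtomSeq.weight P) 0

/-- The canonical extension `μ_P` of `P` to `C(A)`: the sum of the canonical distribution over the
atoms below the given element. For finite `A` this is a finite sum. -/
noncomputable def canonicalExtension (P : A → ℝ) (t : CondAlg A) : ℝ :=
  ∑ᶠ (ω : CondAlg A) (_ : IsAtom ω ∧ ω ≤ t), canonicalDistribution P ω

end Measures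

/-! Separability with `c = ⊤` reads `μ(a ∧ b ∣ ⊤) = μ(a ∣ b) · μ(b ∣ ⊤)`, so `P a = μ(a ∣ ⊤)` does
the job; it is positive because `(a ∣ ⊤) ≠ ⊥` for `a ≠ ⊥`. Conversely, the chain rule for ratios `P
a / P b` is cancellation of `P b`. The real work is the identity `μ_P(a ∣ b) = P(a ∧ b) / P b`,
proved in `canonicalExtension_basicCond`.

It rests on a concrete model of `C(A)`. A sequence of `n - 1` different atoms omits exactly one,
which is regarded as last, so every `b ≠ ⊥` has a unique first atom along the sequence. Sending `(a
∣ b)` to the set of sequences whose first atom under `b` lies under `a` respects the defining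
relations and yields `CondAlg.toSet`, in which `ω_α` becomes `{α}`. Each `ω_α` decides every
element, hence is an atom, and every atom arises so. Thus `μ_P t` is the total weight of the
sequences in the image of `t`.

The weight of a sequence is its probability when atoms are drawn successively without replacement,
with chances proportional to `P`. Draws outside `b` do not affect the relative chances inside `b`,
so for `a ≤ b` the first atom drawn from `b` lies under `a` with probability `P a / P b`
(`sum_drawWeight_leads`). -/

/-! ### Universal properties -/

section Lift

variable {V B D : Type*} [BooleanAlgebra B] [BooleanAlgebra D]

/-- The value of a Boolean term under an assignment of the variables. -/
def BoolTerm.eval (v : V → D) : BoolTerm V → D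
  | var x => v x
  | bot => ⊥
  | top => ⊤
  | inf s t => s.eval v ⊓ t.eval v
  | sup s t => s.eval v ⊔ t.eval v
  | compl s => (s.eval v)ᶜ

theorem BoolTerm.Equivalent.eval_eq (v : V → D) {s t : BoolTerm V} (h : s.Equivalent t) :
    s.eval v = t.eval v := by
  induction h with
  | refl => rfl
  | symm _ ih => exact ih.symm
  | trans _ _ ih₁ ih₂ => exact ih₁.trans ih₂
  | inf_congr _ _ ih₁ ih₂ => simp only [BoolTerm.eval, ih₁, ih₂]
  | sup_congr _ _ ih₁ ih₂ => simp only [BoolTerm.eval, ih₁, ih₂]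
  | compl_congr _ ih => simp only [BoolTerm.eval, ih]
  | inf_comm => exact _root_.inf_comm _ _
  | sup_comm => exact _root_.sup_comm _ _
  | inf_assoc => exact _root_.inf_assoc _ _ _
  | sup_assoc => exact _root_.sup_assoc _ _ _
  | inf_sup_self => exact _root_.inf_sup_self
  | sup_inf_self => exact _root_.sup_inf_self
  | inf_sup_left => exact _root_.inf_sup_left _ _ _
  | sup_inf_left => exact _root_.sup_inf_left _ _ _
  | inf_top => exact inf_top_eq _
  | sup_bot => exact sup_bot_eq _
  | inf_compl => exact inf_compl_self _
  | sup_compl => exact sup_compl_eq_top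

/-- The homomorphism from the free Boolean algebra extending an assignment of the generators. -/
def FreeBoolAlg.lift (v : V → D) : BoundedLatticeHom (FreeBoolAlg V) D where
  toFun := Quotient.lift (BoolTerm.eval v) fun _ _ h => h.eval_eq v
  map_sup' := by rintro ⟨s⟩ ⟨t⟩; rfl
  map_inf' := by rintro ⟨s⟩ ⟨t⟩; rfl
  map_top' := rfl
  map_bot' := rfl

theorem BoolCongGen.map_eq {X : B → B → Prop} (φ : BoundedLatticeHom B D)
    (h : ∀ x y, X x y → φ x = φ y) {x y : B} (hxy : BoolCongGen X x y) : φ x = φ y := by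
  induction hxy with
  | of hx => exact h _ _ hx
  | refl => rfl
  | symm _ ih => exact ih.symm
  | trans _ _ ih₁ ih₂ => exact ih₁.trans ih₂
  | inf _ _ ih₁ ih₂ => rw [map_inf, map_inf, ih₁, ih₂]
  | sup _ _ ih₁ ih₂ => rw [map_sup, map_sup, ih₁, ih₂]
  | compl _ ih => rw [map_compl', map_compl', ih]

/-- The homomorphism from the quotient induced by one that identifies the related pairs. -/
def BoolQuotient.lift {X : B → B → Prop} (φ : BoundedLatticeHom B D)
    (h : ∀ x y, X x y → φ x = φ y) : BoundedLatticeHom (BoolQuotient X) D where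
  toFun := Quotient.lift φ fun _ _ hxy => BoolCongGen.map_eq φ h hxy
  map_sup' := by rintro ⟨s⟩ ⟨t⟩; exact map_sup φ s t
  map_inf' := by rintro ⟨s⟩ ⟨t⟩; exact map_inf φ s t
  map_top' := map_top φ
  map_bot' := map_bot φ

end Lift

/-! ### Calculus of conditionals -/

section Calculus

variable {A : Type*} [BooleanAlgebra A]

theorem CondAlg.induction {p : CondAlg A → Prop}
    (basic : ∀ a b hb, p (basicCond a b hb)) (top : p ⊤)
    (inf : ∀ s t, p s → p t → p (s ⊓ t)) (compl : ∀ s, p s → p sᶜ) (t : CondAlg A) : p t := by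
  have sup : ∀ s t, p s → p t → p (s ⊔ t) := fun s t hs ht => by
    have h := compl _ (inf _ _ (compl _ hs) (compl _ ht))
    rwa [compl_inf, compl_compl, compl_compl] at h
  obtain ⟨⟨t⟩⟩ := t
  induction t with
  | var x => exact basic x.1 x.2.1 x.2.2
  | top => exact top
  | bot =>
    have h := compl _ top
    rw [compl_top] at h
    exact h
  | inf s t hs ht => exact inf _ _ hs ht
  | sup s t hs ht => exact sup _ _ hs ht
  | compl s hs => exact compl _ hs

theorem CondRel.mk_eq {x y : FreeBoolAlg (CondPair A)} (h : CondRel A x y) :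
    BoolQuotient.mk (CondRel A) x = BoolQuotient.mk (CondRel A) y :=
  Quotient.sound (BoolCongGen.of h)

theorem basicCond_self (b : A) (hb : b ≠ ⊥) : basicCond b b hb = ⊤ :=
  (CondRel.self b hb).mk_eq

theorem basicCond_inf (a₁ a₂ b : A) (hb : b ≠ ⊥) :
    basicCond a₁ b hb ⊓ basicCond a₂ b hb = basicCond (a₁ ⊓ a₂) b hb :=
  (CondRel.inf a₁ a₂ b hb).mk_eq

theorem basicCond_compl (a b : A) (hb : b ≠ ⊥) : (basicCond a b hb)ᶜ = basicCond aᶜ b hb :=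
  (CondRel.compl a b hb).mk_eq

theorem basicCond_inf_self (a b : A) (hb : b ≠ ⊥) :
    basicCond (a ⊓ b) b hb = basicCond a b hb :=
  (CondRel.inf_self a b hb).mk_eq

theorem basicCond_chain {a b c : A} (hb : b ≠ ⊥) (hc : c ≠ ⊥) (hab : a ≤ b) (hbc : b ≤ c) :
    basicCond a b hb ⊓ basicCond b c hc = basicCond a c hc :=
  (CondRel.chain a b c hb hc hab hbc).mk_eq

theorem basicCond_mono {a₁ a₂ : A} (b : A) (hb : b ≠ ⊥) (h : a₁ ≤ a₂) :
    basicCond a₁ b hb ≤ basicCond a₂ b hb := by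
  rw [← inf_eq_left, basicCond_inf, inf_eq_left.2 h]

theorem basicCond_bot (b : A) (hb : b ≠ ⊥) : basicCond ⊥ b hb = ⊥ := by
  rw [← inf_compl_self b, ← basicCond_inf, ← basicCond_compl, inf_compl_self]

theorem basicCond_sup (a₁ a₂ b : A) (hb : b ≠ ⊥) :
    basicCond a₁ b hb ⊔ basicCond a₂ b hb = basicCond (a₁ ⊔ a₂) b hb := by
  rw [← compl_inj_iff, compl_sup, basicCond_compl, basicCond_compl, basicCond_compl,
    basicCond_inf, compl_sup]

/-- Below an atom of `C(A)`, each antecedent `b` selects an atom of `A` under `b`. -/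
theorem IsAtom.exists_isAtom_le_basicCond [Finite A] {ω : CondAlg A} (hω : IsAtom ω) (b : A)
    (hb : b ≠ ⊥) : ∃ x : {a : A // IsAtom a}, (x : A) ≤ b ∧ ω ≤ basicCond (x : A) b hb := by
  obtain ⟨a, ha⟩ := (Set.toFinite {a : A | ω ≤ basicCond a b hb}).exists_minimal
    ⟨b, by simp [basicCond_self]⟩
  have hmem : ω ≤ basicCond a b hb := ha.prop
  -- The consequents `c` with `ω ≤ (c ∣ b)` are closed under meets, so a minimal one is least.
  have key : ∀ c, ω ≤ basicCond c b hb → a ≤ c := fun c hc =>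
    (ha.le_of_le (y := a ⊓ c) (by
      change ω ≤ _
      rw [← basicCond_inf]
      exact le_inf hmem hc) inf_le_left).trans inf_le_right
  refine ⟨⟨a, ?_, ?_⟩, key b (by simp [basicCond_self]), hmem⟩
  · rintro rfl
    rw [basicCond_bot] at hmem
    exact hω.1 (le_bot_iff.1 hmem)
  -- The atom `ω` lies below `(c ∣ b)` or below its complement `(cᶜ ∣ b)`. By leastness the former
  -- gives `a ≤ c`, contradicting `c < a`, and the latter gives `c ≤ cᶜ`, so `c = ⊥`.
  · intro c hc
    rcases hω.le_iff.1 (inf_le_left : ω ⊓ basicCond c b hb ≤ ω) with h | h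
    · have h' : ω ≤ basicCond cᶜ b hb := by
        rw [← basicCond_compl]
        exact le_compl_iff_disjoint_right.2 (disjoint_iff.2 h)
      have := hc.le.trans (key _ h')
      simpa using this
    · exact absurd (key c (inf_eq_left.1 h)) hc.not_ge

end Calculus

/-! ### Leading atoms -/

section Lead

variable {A : Type*} [BooleanAlgebra A] {k : ℕ}

/-- `Leads f b x`: the atom `x` lies under `b` and comes first along `f` among the atoms
under `b`, where atoms that `f` misses are taken to come last. -/
def Leads (f : Fin k → {a : A // IsAtom a}) (b : A) (x : {a : A // IsAtom a}) : Prop :=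
  (x : A) ≤ b ∧ ∀ i, (f i : A) ≤ b → ∃ j ≤ i, f j = x

theorem IsAtom.le_compl_of_ne {x y : {a : A // IsAtom a}} (h : x ≠ y) : (x : A) ≤ (y : A)ᶜ :=
  (x.2.disjoint_of_ne y.2 fun e => h (Subtype.ext e)).le_compl_right

theorem IsAtom.not_le_compl_self {x : A} (hx : IsAtom x) : ¬ x ≤ xᶜ := fun h =>
  hx.1 (by simpa using h)

theorem Leads.mono {f : Fin k → {a : A // IsAtom a}} {b c : A} {x : {a : A // IsAtom a}}
    (h : Leads f c x) (hbc : b ≤ c) (hx : (x : A) ≤ b) : Leads f b x :=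
  ⟨hx, fun i hi => h.2 i (hi.trans hbc)⟩

theorem AtomSeq.le_antecedent_iff (f : AtomSeq A) (b : A)
    (i : Fin (Nat.card {a : A // IsAtom a} - 1)) :
    b ≤ f.antecedent i ↔ ∀ j < i, b ≤ (f j : A)ᶜ := by
  simp [AtomSeq.antecedent]

theorem AtomSeq.leads_antecedent (f : AtomSeq A)
    (i : Fin (Nat.card {a : A // IsAtom a} - 1)) : Leads f (f.antecedent i) (f i) := by
  refine ⟨(f.le_antecedent_iff _ _).2 fun j hj =>
    IsAtom.le_compl_of_ne fun e => hj.ne' (f.injective e), fun j hj => ⟨i, ?_, rfl⟩⟩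
  by_contra! hlt
  exact (f j).2.not_le_compl_self ((f.le_antecedent_iff _ _).1 hj j hlt)

theorem AtomSeq.antecedent_congr {f g : AtomSeq A} {i : Fin (Nat.card {a : A // IsAtom a} - 1)}
    (h : ∀ j < i, f j = g j) : f.antecedent i = g.antecedent i := by
  refine eq_of_forall_le_iff fun c => ?_
  rw [f.le_antecedent_iff, g.le_antecedent_iff]
  exact forall₂_congr fun j hj => by rw [h j hj]

variable [Finite A]

theorem exists_isAtom_coe_le {b : A} (hb : b ≠ ⊥) : ∃ x : {a : A // IsAtom a}, (x : A) ≤ b := by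
  obtain ⟨x, hx, hxb⟩ := (eq_bot_or_exists_atom_le b).resolve_left hb
  exact ⟨⟨x, hx⟩, hxb⟩

theorem exists_leads (f : Fin k → {a : A // IsAtom a}) {b : A} (hb : b ≠ ⊥) :
    ∃ x, Leads f b x := by
  classical
  by_cases h : ∃ i, (f i : A) ≤ b
  · obtain ⟨i, hi⟩ := (Set.toFinite {i | (f i : A) ≤ b}).exists_minimal h
    refine ⟨f i, hi.prop, fun j hj => ⟨i, ?_, rfl⟩⟩
    by_contra! hlt
    exact hlt.not_ge (hi.le_of_le hj hlt.le)
  -- If `f` misses every atom under `b`, any such atom leads vacuously.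
  · push Not at h
    obtain ⟨x, hx⟩ := exists_isAtom_coe_le hb
    exact ⟨x, hx, fun i hi => absurd hi (h i)⟩

/-- The `n - 1` entries are different, so there is room for only one more atom. This is what makes
the convention on missed atoms unambiguous. -/
theorem AtomSeq.eq_of_notMem_range (f : AtomSeq A) {x y : {a : A // IsAtom a}}
    (hx : x ∉ Set.range f) (hy : y ∉ Set.range f) : x = y := by
  by_contra hxy
  have h₁ : (Set.range f).ncard = Nat.card {a : A // IsAtom a} - 1 := by
    rw [← Set.image_univ, Set.ncard_image_of_injective _ f.injective, Set.ncard_univ]; simp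
  have h₂ : ({x, y} : Set _).ncard = 2 := Set.ncard_pair hxy
  have h₃ : Disjoint (Set.range f) {x, y} := by
    rw [Set.disjoint_right]
    rintro z (rfl | rfl) <;> assumption
  have h₄ := Set.ncard_union_eq h₃
  have h₅ := Set.ncard_le_card (Set.range f ∪ {x, y})
  omega

/-- Two leaders that occur in `f` each come no later than the other; if neither occurs, both are the
one omitted atom. -/
theorem Leads.unique (f : AtomSeq A) {b : A} {x y : {a : A // IsAtom a}}
    (hx : Leads f b x) (hy : Leads f b y) : x = y := by
  by_cases h : ∃ i, f i = x
  · obtain ⟨i, rfl⟩ := h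
    obtain ⟨j, hji, rfl⟩ := hy.2 i hx.1
    obtain ⟨l, hlj, hl⟩ := hx.2 j hy.1
    have := f.injective hl
    subst this
    rw [le_antisymm hlj hji]
  · by_cases h' : ∃ i, f i = y
    · obtain ⟨i, rfl⟩ := h'
      obtain ⟨j, -, hj⟩ := hx.2 i hy.1
      exact absurd ⟨j, hj⟩ h
    · exact f.eq_of_notMem_range h h'

/-- There is a sequence of atoms along which a given atom comes first. -/
theorem exists_leads_top (x : {a : A // IsAtom a}) : ∃ f : AtomSeq A, Leads f ⊤ x := by
  classical
  have hpos : 0 < Nat.card {a : A // IsAtom a} := Nat.card_pos_iff.2 ⟨⟨x⟩, inferInstance⟩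
  let e := (Finite.equivFin {a : A // IsAtom a}).symm
  -- An enumeration of all atoms beginning with `x`, then cut to its first `n - 1` terms. For `n =
  -- 1` nothing is left, and `x` leads as the omitted atom.
  let e' := e.trans (Equiv.swap (e ⟨0, hpos⟩) x)
  refine ⟨(Fin.castLEEmb (Nat.sub_le _ 1)).trans e'.toEmbedding, le_top, fun i _ =>
    ⟨⟨0, i.pos⟩, Nat.zero_le _, ?_⟩⟩
  exact Equiv.swap_apply_left _ _

end Lead

/-! ### The atoms of the algebra of conditionals -/

section Atoms

variable {A : Type*} [BooleanAlgebra A] [Finite A]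

/-- The sequences of atoms along which `b` is led by an atom under `a`. -/
def leadSet (p : CondPair A) : Set (AtomSeq A) :=
  {f | ∃ x, Leads f p.2.1 x ∧ (x : A) ≤ p.1}

theorem mem_leadSet_iff {f : AtomSeq A} {a b : A} {hb : b ≠ ⊥} {x : {a : A // IsAtom a}}
    (hx : Leads f b x) : f ∈ leadSet (a, ⟨b, hb⟩) ↔ (x : A) ≤ a := by
  refine ⟨?_, fun h => ⟨x, hx, h⟩⟩
  rintro ⟨y, hy, hya⟩
  rwa [hx.unique f hy]

/-- For a fixed sequence, membership for `(a ∣ b)` means `x ≤ a`, where `x` is the leader of `b`; an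
atom respects meets and complements. The chain relation holds because a leader of `c` that lies
under `b ≤ c` is also the leader of `b`. -/
theorem lift_leadSet_eq {s t : FreeBoolAlg (CondPair A)} (h : CondRel A s t) :
    FreeBoolAlg.lift leadSet s = FreeBoolAlg.lift leadSet t := by
  cases h with
  | self b hb =>
    rw [map_top]
    refine Set.eq_univ_of_forall fun f => ?_
    obtain ⟨x, hx⟩ := exists_leads f hb
    exact ⟨x, hx, hx.1⟩
  | inf a₁ a₂ b hb =>
    rw [map_inf]
    ext f
    obtain ⟨x, hx⟩ := exists_leads f hb
    change f ∈ leadSet _ ∧ f ∈ leadSet _ ↔ f ∈ leadSet _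
    rw [mem_leadSet_iff hx, mem_leadSet_iff hx, mem_leadSet_iff hx, le_inf_iff]
  | compl a b hb =>
    rw [map_compl']
    ext f
    obtain ⟨x, hx⟩ := exists_leads f hb
    change ¬ f ∈ leadSet _ ↔ f ∈ leadSet _
    rw [mem_leadSet_iff hx, mem_leadSet_iff hx, le_compl_iff_disjoint_right,
      x.2.not_le_iff_disjoint]
  | inf_self a b hb =>
    ext f
    obtain ⟨x, hx⟩ := exists_leads f hb
    change f ∈ leadSet _ ↔ f ∈ leadSet _
    rw [mem_leadSet_iff hx, mem_leadSet_iff hx, le_inf_iff, and_iff_left hx.1]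
  | chain a b c hb hc hab hbc =>
    rw [map_inf]
    ext f
    obtain ⟨x, hx⟩ := exists_leads f hb
    obtain ⟨y, hy⟩ := exists_leads f hc
    change f ∈ leadSet _ ∧ f ∈ leadSet _ ↔ f ∈ leadSet _
    rw [mem_leadSet_iff hx, mem_leadSet_iff hy, mem_leadSet_iff hy]
    constructor
    · rintro ⟨hxa, hyb⟩
      rwa [(hy.mono hbc hyb).unique f hx]
    · intro hya
      have hyb := hya.trans hab
      exact ⟨(hy.mono hbc hyb).unique f hx ▸ hya, hyb⟩

variable (A) in
/-- The representation of `C(A)` as an algebra of sets of sequences of atoms. -/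
def CondAlg.toSet : BoundedLatticeHom (CondAlg A) (Set (AtomSeq A)) :=
  BoolQuotient.lift (FreeBoolAlg.lift leadSet) fun _ _ => lift_leadSet_eq

theorem mem_toSet_basicCond {f : AtomSeq A} {a b : A} {hb : b ≠ ⊥} :
    f ∈ CondAlg.toSet A (basicCond a b hb) ↔ ∃ x, Leads f b x ∧ (x : A) ≤ a :=
  Iff.rfl

/-- A sequence `g` in the image must have each `f i` as leader of the `i`-th antecedent of `f`. If
`f` and `g` agree before `i`, that antecedent is also the one of `g`, whose leader is `g i`; so they
agree at `i`. -/
theorem AtomSeq.toSet_omega (f : AtomSeq A) : CondAlg.toSet A f.omega = {f} := by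
  have hmem : ∀ g : AtomSeq A, g ∈ CondAlg.toSet A f.omega ↔
      ∀ i, Leads g (f.antecedent i) (f i) := by
    intro g
    rw [AtomSeq.omega, map_finset_inf, Finset.inf_eq_iInf]
    simp only [Function.comp, Finset.mem_univ, iInf_true, Set.iInf_eq_iInter, Set.mem_iInter,
      mem_toSet_basicCond]
    refine forall_congr' fun i => ⟨?_, fun h => ⟨_, h, le_rfl⟩⟩
    rintro ⟨x, hx, hxf⟩
    rwa [← Subtype.ext (((f i).2.le_iff_eq x.2.1).1 hxf)]
  ext g
  rw [hmem, Set.mem_singleton_iff]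
  refine ⟨fun h => ?_, ?_⟩
  · refine DFunLike.ext _ _ fun i => ?_
    induction i using WellFoundedLT.induction with
    | ind i ih =>
      have := h i
      rw [← AtomSeq.antecedent_congr ih] at this
      exact (g.leads_antecedent i).unique g this
  · rintro rfl
    exact g.leads_antecedent

theorem AtomSeq.omega_injective : Function.Injective (AtomSeq.omega (A := A)) := fun f g h => by
  have := congrArg (CondAlg.toSet A) h
  rwa [f.toSet_omega, g.toSet_omega, Set.singleton_eq_singleton_iff] at this

theorem AtomSeq.omega_le_basicCond {f : AtomSeq A} {b : A} (hb : b ≠ ⊥)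
    {x : {a : A // IsAtom a}} (hx : Leads f b x) : f.omega ≤ basicCond (x : A) b hb := by
  by_cases h : ∃ i, f i = x
  · obtain ⟨i, rfl⟩ := h
    -- No entry before `x = f i` lies under `b`. The chain relation then passes from the `i`-th
    -- antecedent down to `b`.
    have hle : b ≤ f.antecedent i := by
      refine (f.le_antecedent_iff _ _).2 fun j hj => ?_
      rw [le_compl_iff_disjoint_left, ← (f j).2.not_le_iff_disjoint]
      intro hjb
      obtain ⟨l, hl, hli⟩ := hx.2 j hjb
      exact (hl.trans_lt hj).ne (f.injective hli)
    calc f.omega ≤ basicCond (f i : A) (f.antecedent i) (f.antecedent_ne_bot i) :=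
          Finset.inf_le (Finset.mem_univ i)
      _ = basicCond (f i : A) b hb ⊓ basicCond b (f.antecedent i) (f.antecedent_ne_bot i) :=
          (basicCond_chain _ _ hx.1 hle).symm
      _ ≤ _ := inf_le_left
  -- If `x` is omitted, `b` has no other atom: that atom would occur in `f`, so `x` would have to
  -- occur before it. Hence `b = x` and the conditional is `⊤`.
  · have hbx : b ≤ x := by
      by_contra hne
      obtain ⟨y, hy⟩ := exists_isAtom_coe_le (b := b \ x) fun e => hne (sdiff_eq_bot_iff.1 e)
      have hyx : y ≠ x := by
        rintro rfl
        exact y.2.not_le_compl_self (hy.trans (sdiff_eq (x := b) ▸ inf_le_right))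
      by_cases hr : ∃ i, f i = y
      · obtain ⟨i, rfl⟩ := hr
        obtain ⟨j, -, hj⟩ := hx.2 i (hy.trans sdiff_le)
        exact h ⟨j, hj⟩
      · exact hyx (f.eq_of_notMem_range hr h)
    have e := le_antisymm hx.1 hbx
    subst e
    rw [basicCond_self]
    exact le_top

/-- The elements decided by `ω_f` are closed under the operations, and the leader of `b` decides
each `(a ∣ b)`. -/
theorem AtomSeq.omega_le_or_le_compl (f : AtomSeq A) (t : CondAlg A) :
    f.omega ≤ t ∨ f.omega ≤ tᶜ := by
  induction t using CondAlg.induction with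
  | basic a b hb =>
    obtain ⟨x, hx⟩ := exists_leads f hb
    have h := AtomSeq.omega_le_basicCond hb hx
    by_cases hxa : (x : A) ≤ a
    · exact .inl (h.trans (basicCond_mono b hb hxa))
    · rw [basicCond_compl]
      exact .inr (h.trans (basicCond_mono b hb
        (le_compl_iff_disjoint_right.2 (x.2.not_le_iff_disjoint.1 hxa))))
  | top => exact .inl le_top
  | inf s t hs ht =>
    rw [compl_inf]
    rcases hs with hs | hs
    · rcases ht with ht | ht
      · exact .inl (le_inf hs ht)
      · exact .inr (ht.trans le_sup_right)
    · exact .inr (hs.trans le_sup_left)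
  | compl s hs => rwa [compl_compl, or_comm]

theorem AtomSeq.omega_le_iff {f : AtomSeq A} {t : CondAlg A} :
    f.omega ≤ t ↔ f ∈ CondAlg.toSet A t := by
  have key : ∀ s, f.omega ≤ s → f ∈ CondAlg.toSet A s := fun s h => by
    have := OrderHomClass.mono (CondAlg.toSet A) h
    rw [f.toSet_omega] at this
    exact this rfl
  refine ⟨key t, fun h => (f.omega_le_or_le_compl t).resolve_right fun h' => ?_⟩
  have := key _ h'
  rw [map_compl'] at this
  exact this h

theorem AtomSeq.isAtom_omega (f : AtomSeq A) : IsAtom f.omega := by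
  have hne : f.omega ≠ ⊥ := fun e => by
    have := f.toSet_omega
    rw [e, map_bot] at this
    exact (Set.singleton_ne_empty f) this.symm
  refine ⟨hne, fun t ht => ?_⟩
  rcases f.omega_le_or_le_compl t with h | h
  · exact absurd h ht.not_ge
  · simpa using ht.le.trans h

/-- The sequence is read off greedily: starting from `⊤`, take the atom of `A` that `ω` selects
under what remains, remove it, and repeat. Then `ω ≤ ω_f`, and `ω_f` is itself an atom. -/
theorem IsAtom.exists_omega_eq [Nontrivial A] {ω : CondAlg A} (hω : IsAtom ω) : ∃ f : AtomSeq A, f.omega = ω := by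
  classical
  obtain ⟨x₀, -⟩ := exists_isAtom_coe_le (top_ne_bot (α := A))
  choose L hL using fun b : {b : A // b ≠ ⊥} => hω.exists_isAtom_le_basicCond b.1 b.2
  -- The default `x₀` only makes the recursion total; it is taken only at `⊥`, which is not reached
  -- in the first `n - 1` steps.
  let L' : A → {a : A // IsAtom a} := fun b => if h : b ≠ ⊥ then L ⟨b, h⟩ else x₀
  have hL' : ∀ b (hb : b ≠ ⊥), (L' b : A) ≤ b ∧ ω ≤ basicCond (L' b : A) b hb := fun b hb => by
    simp only [L', dif_pos hb]; exact hL ⟨b, hb⟩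
  let S : ℕ → A := fun i => Nat.rec ⊤ (fun _ s => s ⊓ (L' s : A)ᶜ) i
  have hS : ∀ i c, c ≤ S i ↔ ∀ j < i, c ≤ (L' (S j) : A)ᶜ := by
    intro i c
    induction i with
    | zero => exact iff_of_true le_top fun j hj => absurd hj j.not_lt_zero
    | succ i ih =>
      change c ≤ S i ⊓ _ ↔ _
      rw [le_inf_iff, ih, Nat.forall_lt_succ_right]
  -- Fewer than `n` removals cannot exhaust the `n` atoms.
  have hSne : ∀ i < Nat.card {a : A // IsAtom a}, S i ≠ ⊥ := by
    intro i hi h0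
    have hsurj : Function.Surjective fun j : Fin i => L' (S j) := by
      intro x
      by_contra! hx
      have : (x : A) ≤ S i := (hS i x).2 fun j hj => IsAtom.le_compl_of_ne (hx ⟨j, hj⟩).symm
      exact x.2.1 (le_bot_iff.1 (h0 ▸ this))
    have := Nat.card_le_card_of_surjective _ hsurj
    simp at this
    omega
  let g : Fin (Nat.card {a : A // IsAtom a} - 1) → {a : A // IsAtom a} := fun i => L' (S i)
  have hSg : ∀ i : Fin (Nat.card {a : A // IsAtom a} - 1), S i ≠ ⊥ := fun i => hSne i (by omega)
  have hg : ∀ i j, i < j → g i ≠ g j := fun i j hij e => by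
    have := (hS j _).1 (hL' _ (hSg j)).1 i hij
    change (g j : A) ≤ (g i : A)ᶜ at this
    rw [e] at this
    exact (g j).2.not_le_compl_self this
  let f : AtomSeq A := ⟨g, fun i j e => by
    rcases lt_trichotomy i j with h | h | h
    · exact absurd e (hg i j h)
    · exact h
    · exact absurd e.symm (hg j i h)⟩
  have hant : ∀ i, f.antecedent i = S i := fun i => by
    refine eq_of_forall_le_iff fun c => ?_
    rw [f.le_antecedent_iff, hS]
    exact ⟨fun h j hj => h ⟨j, hj.trans i.2⟩ hj, fun h j hj => h j hj⟩
  refine ⟨f, ((f.isAtom_omega.le_iff_eq hω.1).1 (Finset.le_inf fun i _ => ?_)).symm⟩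
  have := (hL' _ (hSg i)).2
  simp only [hant]
  exact this

end Atoms

/-! ### Probabilities on finite Boolean algebras -/

section Probability

variable {A : Type*} [BooleanAlgebra A] {P : A → ℝ}

theorem IsProbability.bot (hP : IsProbability P) : P ⊥ = 0 := by
  have := hP.sup ⊥ ⊥ (inf_idem _)
  rw [sup_idem] at this
  linarith

theorem IsProbability.inf_add_inf_compl (hP : IsProbability P) (a b : A) :
    P (a ⊓ b) + P (a ⊓ bᶜ) = P a := by
  rw [← hP.sup _ _ (by rw [inf_inf_inf_comm, inf_compl_self, inf_bot_eq]), ← inf_sup_left,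
    sup_compl_eq_top, inf_top_eq]

theorem IsProbability.sum_inf [Fintype {a : A // IsAtom a}] [Finite A] (hP : IsProbability P)
    (a : A) : ∑ x : {a : A // IsAtom a}, P (x ⊓ a) = P a := by
  classical
  -- The atoms in `T` are split off `a` one at a time; once all are removed, the remaining part is
  -- `⊥`.
  have key : ∀ T : Finset {a : A // IsAtom a},
      ∑ x ∈ T, P (x ⊓ a) + P (a ⊓ T.inf fun x => (x : A)ᶜ) = P a := by
    intro T
    induction T using Finset.induction_on with
    | empty => simp
    | insert x T hx ih =>
      rw [Finset.sum_insert hx, Finset.inf_insert, ← ih,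
        ← hP.inf_add_inf_compl (a ⊓ T.inf fun x => (x : A)ᶜ) x]
      have h₁ : a ⊓ (T.inf fun x => (x : A)ᶜ) ⊓ (x : A) = (x : A) ⊓ a := by
        rw [inf_right_comm, inf_comm a, inf_eq_left]
        refine inf_le_left.trans (Finset.le_inf fun y hy => IsAtom.le_compl_of_ne ?_)
        rintro rfl
        exact hx hy
      have h₂ : a ⊓ (T.inf fun x => (x : A)ᶜ) ⊓ (x : A)ᶜ =
          a ⊓ ((x : A)ᶜ ⊓ T.inf fun x => (x : A)ᶜ) := by
        rw [inf_assoc, inf_comm (T.inf _)]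
      rw [h₁, h₂]
      ring
  have hbot : (Finset.univ.inf fun x : {a : A // IsAtom a} => (x : A)ᶜ) = ⊥ := by
    by_contra h
    obtain ⟨x, hx⟩ := exists_isAtom_coe_le h
    exact x.2.not_le_compl_self (hx.trans (Finset.inf_le (Finset.mem_univ x)))
  have := key Finset.univ
  rwa [hbot, inf_bot_eq, hP.bot, add_zero] at this

end Probability

/-! ### Random sequences of atoms -/

section Sampling

variable {A : Type*} [BooleanAlgebra A] {k : ℕ}

/-- The part of `S` that remains before the `i`-th step of a sequence of atoms. -/
noncomputable def remainder (S : A) (f : Fin k → {a : A // IsAtom a}) (i : Fin k) : A :=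
  S ⊓ (Finset.univ.filter (· < i)).inf fun j => (f j : A)ᶜ

/-- The weight of a sequence of atoms drawn successively from `S` without replacement. -/
noncomputable def drawWeight (P : A → ℝ) (S : A) (f : Fin k → {a : A // IsAtom a}) : ℝ :=
  ∏ i, P ((f i : A) ⊓ remainder S f i) / P (remainder S f i)

theorem remainder_cons_zero (S : A) (x : {a : A // IsAtom a})
    (g : Fin k → {a : A // IsAtom a}) :
    remainder S (Fin.cons x g : Fin (k + 1) → {a : A // IsAtom a}) 0 = S := by
  simp [remainder]

theorem remainder_cons_succ (S : A) (x : {a : A // IsAtom a})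
    (g : Fin k → {a : A // IsAtom a}) (i : Fin k) :
    remainder S (Fin.cons x g : Fin (k + 1) → {a : A // IsAtom a}) i.succ =
      remainder (S ⊓ (x : A)ᶜ) g i := by
  refine eq_of_forall_le_iff fun c => ?_
  simp [remainder, Fin.forall_fin_succ, Finset.le_inf_iff, and_assoc]

theorem drawWeight_cons (P : A → ℝ) (S : A) (x : {a : A // IsAtom a})
    (g : Fin k → {a : A // IsAtom a}) :
    drawWeight P S (Fin.cons x g : Fin (k + 1) → {a : A // IsAtom a}) =
      P (x ⊓ S) / P S * drawWeight P (S ⊓ (x : A)ᶜ) g := by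
  rw [drawWeight, Fin.prod_univ_succ, remainder_cons_zero]
  simp only [Fin.cons_zero, Fin.cons_succ, remainder_cons_succ, drawWeight]

/-- The factor at the second occurrence of an atom vanishes. Sums may therefore run over all
functions rather than embeddings, which permits induction on the first draw. -/
theorem drawWeight_eq_zero_of_not_injective {P : A → ℝ} (hP : IsProbability P) (S : A)
    {f : Fin k → {a : A // IsAtom a}} (hf : ¬ Function.Injective f) : drawWeight P S f = 0 := by
  have : ∃ i j, i < j ∧ f i = f j := by
    by_contra! h
    refine hf fun i j e => ?_
    rcases lt_trichotomy i j with hij | hij | hij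
    · exact absurd e (h i j hij)
    · exact hij
    · exact absurd e.symm (h j i hij)
  obtain ⟨i, j, hij, e⟩ := this
  refine Finset.prod_eq_zero (Finset.mem_univ j) ?_
  have : (f j : A) ⊓ remainder S f j = ⊥ := by
    refine le_bot_iff.1 ((inf_le_inf_left _ (inf_le_right.trans (Finset.inf_le (b := i) (by simpa
      using hij)))).trans ?_)
    rw [e, inf_compl_self]
  rw [this, hP.bot, zero_div]

theorem leads_cons_of_le {b : A} {x y : {a : A // IsAtom a}} (hx : (x : A) ≤ b)
    (g : Fin k → {a : A // IsAtom a}) :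
    Leads (Fin.cons x g : Fin (k + 1) → {a : A // IsAtom a}) b y ↔ y = x := by
  constructor
  · rintro ⟨-, h⟩
    obtain ⟨j, hj, e⟩ := h 0 hx
    rw [Fin.le_zero_iff.1 hj] at e
    exact e.symm
  · rintro rfl
    exact ⟨hx, fun i _ => ⟨0, Fin.zero_le _, rfl⟩⟩

theorem leads_cons_of_not_le {b : A} {x y : {a : A // IsAtom a}} (hx : ¬ (x : A) ≤ b)
    (g : Fin k → {a : A // IsAtom a}) :
    Leads (Fin.cons x g : Fin (k + 1) → {a : A // IsAtom a}) b y ↔ Leads g b y := by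
  refine and_congr_right fun hy => ?_
  have hxy : x ≠ y := by
    rintro rfl
    exact hx hy
  simp [Fin.forall_fin_succ, Fin.exists_fin_succ, hx, hxy]

theorem inf_eq_bot_of_not_le {x : {a : A // IsAtom a}} {S : A} (h : ¬ (x : A) ≤ S) :
    (x : A) ⊓ S = ⊥ :=
  disjoint_iff.1 (x.2.not_le_iff_disjoint.1 h)

theorem Fin.sum_univ_pi_succ {α M : Type*} [Fintype α] [AddCommMonoid M]
    (F : (Fin (k + 1) → α) → M) :
    ∑ f, F f = ∑ x, ∑ g : Fin k → α, F (Fin.cons x g : Fin (k + 1) → α) := by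
  rw [← Fintype.sum_prod_type', ← (Fin.consEquiv fun _ => α).sum_comp]
  rfl

theorem card_atoms_inf_compl [Finite A] {S : A} {x : {a : A // IsAtom a}} (hx : (x : A) ≤ S) :
    Nat.card {y : {a : A // IsAtom a} // (y : A) ≤ S ⊓ (x : A)ᶜ} + 1 =
      Nat.card {y : {a : A // IsAtom a} // (y : A) ≤ S} := by
  have : {y : {a : A // IsAtom a} | (y : A) ≤ S ⊓ (x : A)ᶜ} =
      {y : {a : A // IsAtom a} | (y : A) ≤ S} \ {x} := by
    ext y
    simp only [le_inf_iff, Set.mem_ofPred_eq, Set.mem_sdiff, Set.mem_singleton_iff]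
    refine and_congr_right fun _ => ⟨?_, IsAtom.le_compl_of_ne⟩
    rintro h rfl
    exact y.2.not_le_compl_self h
  have h := Set.ncard_sdiff_singleton_add_one (s := {y : {a : A // IsAtom a} | (y : A) ≤ S}) hx
  rwa [← this] at h

variable [Finite A] [Fintype {a : A // IsAtom a}] {P : A → ℝ}

/-- Condition on the first draw. The bound on `k` keeps the remaining part nonzero, so no
denominator vanishes. -/
theorem sum_drawWeight (hP : IsPositiveProbability P) (S : A)
    (hS : k < Nat.card {y : {a : A // IsAtom a} // (y : A) ≤ S}) :
    ∑ f : Fin k → {a : A // IsAtom a}, drawWeight P S f = 1 := by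
  induction k generalizing S with
  | zero => simp [drawWeight]
  | succ k ih =>
    have hS0 : S ≠ ⊥ := by
      rintro rfl
      have : IsEmpty {y : {a : A // IsAtom a} // (y : A) ≤ ⊥} :=
        ⟨fun y => y.1.2.1 (le_bot_iff.1 y.2)⟩
      rw [Nat.card_of_isEmpty] at hS
      omega
    have hPS := (hP.pos S hS0).ne'
    rw [Fin.sum_univ_pi_succ]
    simp only [drawWeight_cons, ← Finset.mul_sum]
    rw [Finset.sum_congr rfl (g := fun x : {a : A // IsAtom a} => P (x ⊓ S) / P S), ← Finset.sum_div,
      hP.sum_inf, div_self hPS]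
    intro x _
    by_cases hx : (x : A) ≤ S
    · have := card_atoms_inf_compl hx
      rw [ih _ (by omega), mul_one]
    · rw [inf_eq_bot_of_not_le hx, hP.bot]
      simp

open Classical in
/-- When atoms are drawn from `S` without replacement, the first one drawn from `b` lies
under `a` with probability `P a / P b`. -/
theorem sum_drawWeight_leads (hP : IsPositiveProbability P) {S a b : A} (hb : b ≠ ⊥)
    (hab : a ≤ b) (hbS : b ≤ S)
    (hS : Nat.card {y : {a : A // IsAtom a} // (y : A) ≤ S} = k + 1) :
    ∑ f : Fin k → {a : A // IsAtom a},
      (if ∃ x, Leads f b x ∧ (x : A) ≤ a then drawWeight P S f else 0) = P a / P b := by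
  have hPb := (hP.pos b hb).ne'
  induction k generalizing S with
  -- Here `S` contains a single atom, the omitted one, so `a` is `⊥` or `b`.
  | zero =>
    have hsub : ∀ y z : {a : A // IsAtom a}, (y : A) ≤ S → (z : A) ≤ S → y = z := by
      have := (Nat.card_eq_one_iff_unique.1 hS).1
      exact fun y z hy hz => congrArg Subtype.val
        (Subsingleton.elim (⟨y, hy⟩ : {y : {a : A // IsAtom a} // (y : A) ≤ S}) ⟨z, hz⟩)
    have hL : ∀ (f : Fin 0 → {a : A // IsAtom a}),
        (∃ x, Leads f b x ∧ (x : A) ≤ a) ↔ a ≠ ⊥ := fun f => by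
      refine ⟨?_, fun h => ?_⟩
      · rintro ⟨x, -, hx⟩ rfl
        exact x.2.1 (le_bot_iff.1 hx)
      · obtain ⟨x, hx⟩ := exists_isAtom_coe_le h
        exact ⟨x, ⟨hx.trans hab, fun i => i.elim0⟩, hx⟩
    simp only [hL, drawWeight]
    by_cases ha : a = ⊥
    · simp [ha, hP.bot]
    · have : a = b := by
        refine le_antisymm hab ?_
        by_contra hne
        obtain ⟨y, hy⟩ := exists_isAtom_coe_le (b := b \ a) fun e => hne (sdiff_eq_bot_iff.1 e)
        obtain ⟨x, hx⟩ := exists_isAtom_coe_le ha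
        have e := hsub x y ((hx.trans hab).trans hbS) ((hy.trans sdiff_le).trans hbS)
        subst e
        exact x.2.1 (le_bot_iff.1 (disjoint_sdiff_self_right hx hy))
      subst this
      simp [ha, div_self hPb]
  | succ k ih =>
    have hPS := (hP.pos S fun e => hb (le_bot_iff.1 (e ▸ hbS))).ne'
    -- A first draw `x` under `a` succeeds and one under `b` but not `a` fails. One outside `b`
    -- leaves the same problem for `S ⊓ xᶜ`, which still contains `b`. The right-hand side encodes
    -- all cases at once.
    have hterm : ∀ x : {a : A // IsAtom a}, ∑ g : Fin k → {a : A // IsAtom a},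
        (if ∃ y, Leads (Fin.cons x g : Fin (k + 1) → {a : A // IsAtom a}) b y ∧ (y : A) ≤ a
          then drawWeight P S (Fin.cons x g : Fin (k + 1) → {a : A // IsAtom a}) else 0) =
        (P (x ⊓ a) + (P (x ⊓ S) - P (x ⊓ b)) * (P a / P b)) / P S := by
      intro x
      have hpull : ∀ (p : (Fin k → {a : A // IsAtom a}) → Prop) (_ : DecidablePred p),
          (∑ g, if p g then drawWeight P S (Fin.cons x g : Fin (k + 1) → {a : A // IsAtom a})
            else 0) =
          P (x ⊓ S) / P S * ∑ g, if p g then drawWeight P (S ⊓ (x : A)ᶜ) g else 0 := by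
        intro p _
        rw [Finset.mul_sum]
        exact Finset.sum_congr rfl fun g _ => by rw [drawWeight_cons]; split_ifs <;> simp
      refine (hpull (fun g => ∃ y, Leads (Fin.cons x g : Fin (k + 1) → {a : A // IsAtom a}) b y ∧
        (y : A) ≤ a) _).trans ?_
      by_cases hxb : (x : A) ≤ b
      · have hxS := hxb.trans hbS
        have hcard := card_atoms_inf_compl hxS
        simp only [leads_cons_of_le hxb, exists_eq_left]
        rw [inf_eq_left.2 hxS, inf_eq_left.2 hxb]
        by_cases hxa : (x : A) ≤ a
        · simp only [hxa, if_true]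
          rw [sum_drawWeight hP _ (by omega), inf_eq_left.2 hxa]
          ring
        · simp [hxa, inf_eq_bot_of_not_le hxa, hP.bot]
      · simp only [leads_cons_of_not_le hxb]
        rw [inf_eq_bot_of_not_le hxb, inf_eq_bot_of_not_le fun h => hxb (h.trans hab), hP.bot]
        by_cases hxS : (x : A) ≤ S
        · have hcard := card_atoms_inf_compl hxS
          rw [ih (le_inf hbS (le_compl_iff_disjoint_left.2 (x.2.not_le_iff_disjoint.1 hxb)))
            (by omega)]
          ring
        · rw [inf_eq_bot_of_not_le hxS, hP.bot]
          simp
    -- Summing over `x` leaves `(P a + (P S - P b) * (P a / P b)) / P S = P a / P b`.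
    rw [Fin.sum_univ_pi_succ, Finset.sum_congr rfl fun x _ => hterm x, ← Finset.sum_div,
      Finset.sum_add_distrib, ← Finset.sum_mul, Finset.sum_sub_distrib, hP.sum_inf, hP.sum_inf,
      hP.sum_inf]
    field_simp
    ring

end Sampling

/-! ### The canonical extension -/

section CanonicalExtension

variable {A : Type*} [BooleanAlgebra A] {P : A → ℝ}

theorem AtomSeq.weight_eq_drawWeight (P : A → ℝ) (f : AtomSeq A) :
    f.weight P = drawWeight P ⊤ f := by
  simp only [AtomSeq.weight, drawWeight, remainder, top_inf_eq, AtomSeq.antecedent]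

variable [Finite A] [Nontrivial A]

/-- The map `α ↦ ω_α` is a bijection from the image of `t` onto the atoms below `t`. -/
theorem canonicalExtension_eq_finsum (P : A → ℝ) (t : CondAlg A) :
    canonicalExtension P t = ∑ᶠ f ∈ CondAlg.toSet A t, AtomSeq.weight P f := by
  have himg : {ω : CondAlg A | IsAtom ω ∧ ω ≤ t} = AtomSeq.omega '' CondAlg.toSet A t := by
    ext ω
    constructor
    · rintro ⟨hω, hωt⟩
      obtain ⟨f, rfl⟩ := hω.exists_omega_eq
      exact ⟨f, AtomSeq.omega_le_iff.1 hωt, rfl⟩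
    · rintro ⟨f, hf, rfl⟩
      exact ⟨f.isAtom_omega, AtomSeq.omega_le_iff.2 hf⟩
  change ∑ᶠ ω ∈ {ω : CondAlg A | IsAtom ω ∧ ω ≤ t}, _ = _
  rw [himg, finsum_mem_image AtomSeq.omega_injective.injOn]
  exact finsum_mem_congr rfl fun f _ => AtomSeq.omega_injective.extend_apply _ _ f

theorem canonicalExtension_basicCond (hP : IsPositiveProbability P) (a b : A) (hb : b ≠ ⊥) :
    canonicalExtension P (basicCond a b hb) = P (a ⊓ b) / P b := by
  classical
  have := Fintype.ofFinite {a : A // IsAtom a}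
  have := Fintype.ofFinite (AtomSeq A)
  obtain ⟨x₀, -⟩ := exists_isAtom_coe_le (top_ne_bot (α := A))
  have hcard : Nat.card {y : {a : A // IsAtom a} // (y : A) ≤ ⊤} =
      Nat.card {a : A // IsAtom a} - 1 + 1 := by
    have : 0 < Nat.card {a : A // IsAtom a} := Nat.card_pos_iff.2 ⟨⟨x₀⟩, inferInstance⟩
    rw [Nat.sub_add_cancel this]
    exact Nat.card_congr (Equiv.subtypeUnivEquiv fun _ => le_top)
  -- Replacing `a` by `a ⊓ b` supplies the hypothesis that the consequent lies under the antecedent.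
  rw [← basicCond_inf_self, canonicalExtension_eq_finsum,
    ← sum_drawWeight_leads hP hb inf_le_right le_top hcard, finsum_mem_def,
    finsum_eq_sum_of_fintype]
  refine Fintype.sum_of_injective (fun f : AtomSeq A => (f : Fin _ → {a : A // IsAtom a}))
    DFunLike.coe_injective _ _ (fun g hg => ?_) fun f => ?_
  · have : ¬ Function.Injective g := fun h => hg ⟨⟨g, h⟩, rfl⟩
    rw [drawWeight_eq_zero_of_not_injective hP.toIsProbability _ this, ite_self]
  · rw [Set.indicator_apply, mem_toSet_basicCond, AtomSeq.weight_eq_drawWeight]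
    congr

end CanonicalExtension

/-! ### Separable probabilities -/

/-- A sequence along which an atom under `a` comes first belongs to the image of `(a ∣ ⊤)`. This
gives positivity of `P`. -/
theorem basicCond_top_ne_bot {A : Type*} [BooleanAlgebra A] [Finite A] {a : A} (ha : a ≠ ⊥)
    (h : (⊤ : A) ≠ ⊥) : basicCond a ⊤ h ≠ ⊥ := by
  intro e
  obtain ⟨x, hx⟩ := exists_isAtom_coe_le ha
  obtain ⟨f, hf⟩ := exists_leads_top x
  have hmem : f ∈ CondAlg.toSet A (basicCond a ⊤ h) := mem_toSet_basicCond.2 ⟨x, hf, hx⟩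
  rw [e, map_bot] at hmem
  exact hmem

/-- The probability on `A` obtained from one on `C(A)` by conditioning on `⊤`. -/
theorem IsPositiveProbability.basicCond_top {A : Type*} [BooleanAlgebra A] [Finite A]
    {μ : CondAlg A → ℝ} (hμ : IsPositiveProbability μ) (h : (⊤ : A) ≠ ⊥) :
    IsPositiveProbability fun a => μ (basicCond a ⊤ h) where
  mem_Icc a := hμ.mem_Icc _
  top := by rw [basicCond_self, hμ.top]
  sup a b hab := by
    rw [← basicCond_sup, hμ.sup]
    rw [basicCond_inf, hab, basicCond_bot]
  pos a ha := hμ.pos _ (basicCond_top_ne_bot ha h)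

theorem corollary6p10 {A : Type*} [BooleanAlgebra A] [Finite A] [Nontrivial A]
    (μ : CondAlg A → ℝ) (hμ : IsPositiveProbability μ) :
    IsSeparableProb μ ↔
      ∃ P : A → ℝ, IsPositiveProbability P ∧
        ∀ (a b : A) (hb : b ≠ ⊥),
          μ (basicCond a b hb) = P (a ⊓ b) / P b ∧
          P (a ⊓ b) / P b = canonicalExtension P (basicCond a b hb) := by
  constructor
  · intro hsep
    have hP := hμ.basicCond_top top_ne_bot
    refine ⟨_, hP, fun a b hb => ⟨?_, (canonicalExtension_basicCond hP a b hb).symm⟩⟩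
    rw [eq_div_iff (hP.pos b hb).ne', ← basicCond_inf_self a b hb]
    -- The chain rule for `a ⊓ b ≤ b ≤ ⊤`; the other instances of separability are not needed.
    exact (hsep (a ⊓ b) b ⊤ hb top_ne_bot inf_le_right le_top).symm
  · rintro ⟨P, hP, h⟩ a b c hb hc hab hbc
    have hPb := (hP.pos b hb).ne'
    rw [(h a c hc).1, (h a b hb).1, (h b c hc).1, inf_eq_left.2 hab, inf_eq_left.2 hbc,
      inf_eq_left.2 (hab.trans hbc)]
    field_simp
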